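/- Let $M$ be a von Neumann algebra, and let $A \subseteq M$ be a weak* closed unital (not necessarily selfadjoint) subalgebra, with $1_A = 1_M$. A state on $A$ or on $M$ is a contractive linear functional $\varphi$ with $\varphi(1) = 1$; a map is called normal if it is weak* continuous. Suppose that $A$ has the following Gleason-Whitney type property: whenever $\varphi$ is a weak* continuous state on $A$ and $\psi$ is a state on $M$ with $\psi|_A = \varphi$, then $\psi$ is normal. Let $D \subseteq B(H)$ be a von Neumann algebra on a Hilbert space $H$, and let $\Phi : A \to D$ be a linear map that is unital, weak* continuous and completely contractive (that is, for every $n$ the map $[a_{ij}] \mapsto [\Phi(a_{ij})]$ from $M_n(A) \subseteq M_n(M)$ to $M_n(D)$ is contractive). Then there is a normal completely positive linear map $\Psi : M \to B(H)$ with $\Psi(a) = \Phi(a)$ for all $a \in A$. -/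

import Mathlib

open scoped CStarAlgebra Topology

/-- The σ-weak (ultraweak) topology on `B(H)`, i.e. the weak* topology of `B(H)` as the dual of
the trace class operators: the coarsest topology that makes all the functionals
`x ↦ ∑ₙ ⟪ξₙ, x ηₙ⟫` continuous, for square summable sequences `ξ`, `η` in `H`. -/
@[reducible]
noncomputable def weakStarTopologyBH (H : Type*) [NormedAddCommGroup H] [InnerProductSpace ℂ H] :
    TopologicalSpace (H →L[ℂ] H) :=
  ⨅ (ξ : lp (fun _ : ℕ => H) 2) (η : lp (fun _ : ℕ => H) 2),
    TopologicalSpace.induced (fun x : H →L[ℂ] H => ∑' n, inner ℂ (ξ n) (x (η n))) inferInstance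

namespace VonNeumannAlgebra

variable {H : Type*} [NormedAddCommGroup H] [InnerProductSpace ℂ H] [CompleteSpace H]

/-- The weak* topology of a von Neumann algebra on `H`: the σ-weak topology inherited from
`B(H)`. -/
@[reducible]
noncomputable def weakStarTopology (M : VonNeumannAlgebra H) : TopologicalSpace M.toStarSubalgebra :=
  TopologicalSpace.induced (fun x => (x : H →L[ℂ] H)) (weakStarTopologyBH H)

/-- A von Neumann algebra is norm closed. -/
instance instIsClosed (M : VonNeumannAlgebra H) :
    IsClosed (M.toStarSubalgebra : Set (H →L[ℂ] H)) := by
  have h : (M.toStarSubalgebra : Set (H →L[ℂ] H)) =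
      Set.centralizer (Set.centralizer (M : Set (H →L[ℂ] H))) := by
    rw [M.centralizer_centralizer]; rfl
  rw [h]
  exact Set.isClosed_centralizer _

/-- With the order inherited from `B(H)`, a von Neumann algebra is a star-ordered ring:
its elements that are positive operators are the sums of elements `s* s` of the algebra. -/
instance instStarOrderedRing (M : VonNeumannAlgebra H) : StarOrderedRing M.toStarSubalgebra where
  le_iff x y := by
    constructor
    · intro h
      have h0 : (0 : H →L[ℂ] H) ≤ ((y - x : M.toStarSubalgebra) : H →L[ℂ] H) := by
        simpa using! h
      have hsa : IsSelfAdjoint (y - x) := Subtype.ext (IsSelfAdjoint.of_nonneg h0).star_eq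
      have hsp : SpectrumRestricts (y - x) ContinuousMap.realToNNReal := by
        rw [SpectrumRestricts.nnreal_iff]
        intro r hr
        have h1 : (r : ℂ) ∈ spectrum ℂ (y - x) := by
          simpa using spectrum.algebraMap_mem ℂ hr
        rw [StarSubalgebra.spectrum_eq] at h1
        exact spectrum_nonneg_of_nonneg (𝕜 := ℝ) h0
          (spectrum.of_algebraMap_mem (S := ℂ) (by simpa using h1))
      obtain ⟨s, hs, -, hs2⟩ := CFC.exists_sqrt_of_isSelfAdjoint_of_quasispectrumRestricts hsa hsp
      refine ⟨s * s, AddSubmonoid.subset_closure ⟨s, by simp [hs.star_eq]⟩, ?_⟩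
      rwa [eq_sub_iff_add_eq', eq_comm] at hs2
    · rintro ⟨p, hp, rfl⟩
      have h0 : (0 : H →L[ℂ] H) ≤ (p : H →L[ℂ] H) := by
        induction hp using AddSubmonoid.closure_induction with
        | mem _ hx => obtain ⟨s, rfl⟩ := hx; exact star_mul_self_nonneg (s : H →L[ℂ] H)
        | zero => exact le_rfl
        | add a b _ _ ha hb => exact add_nonneg ha hb
      change (x : H →L[ℂ] H) ≤ (x : H →L[ℂ] H) + (p : H →L[ℂ] H)
      exact le_add_of_nonneg_right h0

end VonNeumannAlgebra

/-- A state on a unital operator algebra: a contractive linear functional `φ` with `φ 1 = 1`. -/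
def IsUnitalContractiveState {E : Type*} [NormedRing E] [NormedSpace ℂ E] (φ : E →ₗ[ℂ] ℂ) : Prop :=
  (∀ x, ‖φ x‖ ≤ ‖x‖) ∧ φ 1 = 1

/-- Complete contractivity of a linear map `Φ : A → N`, for a subalgebra `A` of a C⋆-algebra `M`
and a C⋆-algebra `N`: each amplification `[aᵢⱼ] ↦ [Φ aᵢⱼ]` is contractive, where `Mₙ(A)` has the
norm inherited from the C⋆-algebra `Mₙ(M)`. -/
def IsCompletelyContractive {M N : Type*} [CStarAlgebra M] [PartialOrder M] [StarOrderedRing M]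
    [CStarAlgebra N] [PartialOrder N] [StarOrderedRing N] (A : Subalgebra ℂ M)
    (Φ : A →ₗ[ℂ] N) : Prop :=
  ∀ (n : ℕ) (a : CStarMatrix (Fin n) (Fin n) A), ‖a.map Φ‖ ≤ ‖a.map (Subtype.val : A → M)‖

/-- The weak* topology on a subalgebra of a von Neumann algebra `M`, inherited from `M`. -/
@[reducible]
noncomputable def VonNeumannAlgebra.weakStarTopologyOn {H : Type*} [NormedAddCommGroup H]
    [InnerProductSpace ℂ H] [CompleteSpace H] (M : VonNeumannAlgebra H)
    (A : Subalgebra ℂ M.toStarSubalgebra) : TopologicalSpace A :=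
  TopologicalSpace.induced (fun a => (a : M.toStarSubalgebra)) M.weakStarTopology

/-! Every completely positive extension of `Φ` is automatically normal. Given such a `Ψ` and a
square-summable `ζ`, the functional `x ↦ ∑ ⟪ζₙ, Ψ x ζₙ⟫` is positive, hence a multiple of a state on
`M`. On `A` it depends only on `Φ`, so it is weak* continuous there, and the Gleason-Whitney
property makes it normal on `M`. Polarization passes from these diagonal functionals to all σ-weak
ones.

Existence of `Ψ` is Arveson's theorem (`exists_completelyPositive_extension`). A finite orthonormal
family turns `Φ` into a functional on matrices over `A` whose norm is attained at `1`; its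
Hahn-Banach extension is then positive (`exists_positive_extension`) and encodes an extension of the
compressed map. An ultrafilter limit over finite parts of a Hilbert basis removes the compression.
The limit is taken on scalar kernels (`IsPositiveKernel`), where compactness of discs in `ℂ`
suffices. -/

open scoped ComplexOrder InnerProductSpace

/-! ### Positive functionals on a C⋆-algebra. -/

section PositiveFunctionals

variable {B : Type*} [CStarAlgebra B] [PartialOrder B] [StarOrderedRing B]

lemma exists_eq_star_mul_self {x : B} (hx : 0 ≤ x) : ∃ y, x = star y * y :=
  CStarAlgebra.nonneg_iff_eq_star_mul_self.1 hx

/-- A linear functional that is nonnegative on nonnegative elements is hermitian. -/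
lemma positiveFunctional_star {f : B →ₗ[ℂ] ℂ} (hf : ∀ x, 0 ≤ x → 0 ≤ f x) (x : B) :
    f (star x) = star (f x) := by
  obtain ⟨y, hy, -, hx⟩ := CStarAlgebra.exists_sum_four_nonneg x
  have hr (i : Fin 4) : star (f (y i)) = f (y i) := (IsSelfAdjoint.of_nonneg (hf _ (hy i))).star_eq
  have hs (i : Fin 4) : star (y i) = y i := (IsSelfAdjoint.of_nonneg (hy i)).star_eq
  rw [hx]
  simp only [star_sum, map_sum, star_smul, map_smul, hs, smul_eq_mul, star_mul', hr]

/-- A positive functional is bounded by its value at `1`. -/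
lemma positiveFunctional_norm_le {f : B →ₗ[ℂ] ℂ} (hf : ∀ x, 0 ≤ x → 0 ≤ f x) (x : B) :
    ‖f x‖ ≤ ‖x‖ * (f 1).re := by
  -- Rotating by a phase makes the value real, so only the selfadjoint part of `c • x` matters.
  obtain ⟨c, hc, hcx⟩ : ∃ c : ℂ, ‖c‖ = 1 ∧ c * f x = ‖f x‖ := by
    by_cases h : f x = 0
    · exact ⟨1, by simp, by simp [h]⟩
    · refine ⟨‖f x‖ / f x, ?_, ?_⟩
      · have : ‖f x‖ ≠ 0 := norm_ne_zero_iff.2 h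
        simp [this]
      · field_simp
  set z : B := (realPart (c • x) : B) with hz
  have hzsa : IsSelfAdjoint z := (realPart (c • x)).2
  have h1 : f z = (‖f x‖ : ℂ) := by
    rw [hz, realPart_apply_coe, ← Complex.coe_smul, map_smul, map_add, positiveFunctional_star hf,
      map_smul, smul_eq_mul, smul_eq_mul, hcx]
    simp
    ring
  have h2 : 0 ≤ f (algebraMap ℝ B ‖z‖ - z) := hf _ (sub_nonneg.2 hzsa.le_algebraMap_norm_self)
  rw [map_sub, h1, Algebra.algebraMap_eq_smul_one, ← Complex.coe_smul, map_smul, smul_eq_mul] at h2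
  have h3 := (Complex.le_def.1 h2).1
  simp at h3
  have h4 : ‖z‖ ≤ ‖x‖ := (realPart.norm_le (c • x)).trans (by simp [norm_smul, hc])
  have h5 : 0 ≤ (f 1).re := (Complex.le_def.1 (hf 1 zero_le_one)).1
  nlinarith

/-- A functional whose norm is its value at `1` is positive. -/
lemma nonneg_of_norm_le_of_map_one {f : B →ₗ[ℂ] ℂ} {c : ℝ} (hc : 0 ≤ c)
    (hf : ∀ x, ‖f x‖ ≤ ‖x‖ * c) (h1 : f 1 = c) {x : B} (hx : 0 ≤ x) : 0 ≤ f x := by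
  have hsa : IsSelfAdjoint x := .of_nonneg hx
  have him : (f x).im = 0 := by
    -- Test on `x + it`: the `t ^ 2 * c ^ 2` terms cancel, and the remaining term linear in `t`
    -- cannot stay bounded unless `(f x).im = 0`.
    have key (t : ℝ) : ((f x).im + t * c) ^ 2 ≤ (‖x‖ ^ 2 + t ^ 2) * c ^ 2 := by
      set w : B := x + ((t : ℂ) * Complex.I) • (1 : B) with hw
      have hs : star w * w = x * x + algebraMap ℝ B (t ^ 2) := by
        have hI : star ((t : ℂ) * Complex.I) = -((t : ℂ) * Complex.I) := by simp
        rw [hw, star_add, star_smul, star_one, hsa.star_eq, hI, Algebra.algebraMap_eq_smul_one,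
          ← Complex.coe_smul]
        simp only [add_mul, mul_add, smul_mul_assoc, mul_smul_comm, one_mul, mul_one, smul_add]
        have : (-((t : ℂ) * Complex.I)) * ((t : ℂ) * Complex.I) = ((t ^ 2 : ℝ) : ℂ) := by
          push_cast
          linear_combination (-(t : ℂ) ^ 2) * Complex.I_sq
        rw [smul_smul, mul_comm ((t : ℂ) * Complex.I), this, neg_smul]
        abel
      have hwn : ‖w‖ ^ 2 ≤ ‖x‖ ^ 2 + t ^ 2 := by
        rw [sq, ← CStarRing.norm_star_mul_self, hs]
        refine (norm_add_le _ _).trans (add_le_add ?_ ?_)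
        · exact (norm_mul_le _ _).trans (sq _).ge
        · rw [Algebra.algebraMap_eq_smul_one, norm_smul, Real.norm_of_nonneg (sq_nonneg t)]
          exact mul_le_of_le_one_right (sq_nonneg t) <| by
            rcases subsingleton_or_nontrivial B with h | h
            · simp [Subsingleton.elim (1 : B) 0]
            · exact CStarRing.norm_one.le
      have hfw : f w = f x + t * c * Complex.I := by
        rw [hw, map_add, map_smul, h1, smul_eq_mul]; ring
      have h3 : |(f x).im + t * c| ≤ ‖w‖ * c := by
        refine le_trans ?_ (hf w)
        rw [hfw]
        refine le_trans (le_of_eq ?_) (Complex.abs_im_le_norm _)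
        simp
      calc ((f x).im + t * c) ^ 2 = |(f x).im + t * c| ^ 2 := (sq_abs _).symm
        _ ≤ (‖w‖ * c) ^ 2 := by gcongr
        _ = ‖w‖ ^ 2 * c ^ 2 := by ring
        _ ≤ _ := by gcongr
    rcases hc.eq_or_lt with rfl | hc
    · have := hf x
      rw [mul_zero] at this
      rw [norm_le_zero_iff.1 this]; rfl
    · by_contra h
      have := key ((‖x‖ ^ 2 * c ^ 2) / (f x).im / c)
      have e : (f x).im * (‖x‖ ^ 2 * c ^ 2 / (f x).im / c * c) = ‖x‖ ^ 2 * c ^ 2 := by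
        field_simp
      have h6 : 0 < (f x).im ^ 2 := by positivity
      have h7 : 0 ≤ ‖x‖ ^ 2 * c ^ 2 := by positivity
      nlinarith
  have hre : 0 ≤ (f x).re := by
    have hle : ‖algebraMap ℝ B ‖x‖ - x‖ ≤ ‖x‖ := by
      have h0 : 0 ≤ algebraMap ℝ B ‖x‖ - x := sub_nonneg.2 hsa.le_algebraMap_norm_self
      rw [CStarAlgebra.norm_le_iff_le_algebraMap _ (norm_nonneg x) h0]
      exact sub_le_self _ hx
    have h2 := (hf (algebraMap ℝ B ‖x‖ - x)).trans (mul_le_mul_of_nonneg_right hle hc)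
    rw [map_sub, Algebra.algebraMap_eq_smul_one, ← Complex.coe_smul, map_smul, smul_eq_mul, h1]
      at h2
    have h3 := (Complex.re_le_norm _).trans h2
    simp at h3
    exact h3
  exact Complex.le_def.2 ⟨hre, him.symm⟩

/-- An element `T` is nonnegative when a separating family of positive functionals is nonnegative
on all the elements `y⋆ T y`. -/
lemma nonneg_of_separating_functionals {X : Type*} {T : B} (f : X → B →ₗ[ℂ] ℂ)
    (hf : ∀ ζ x, 0 ≤ x → 0 ≤ f ζ x) (hsep : ∀ x, (∀ ζ, f ζ x = 0) → x = 0)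
    (hT : ∀ ζ y, 0 ≤ f ζ (star y * T * y)) : 0 ≤ T := by
  have hsa : IsSelfAdjoint T := by
    refine sub_eq_zero.1 (hsep _ fun ζ => ?_)
    have h := IsSelfAdjoint.of_nonneg (hT ζ 1)
    simp only [star_one, one_mul, mul_one] at h
    rw [map_sub, positiveFunctional_star (hf ζ), h.star_eq, sub_self]
  have hn : IsSelfAdjoint T⁻ := .of_nonneg (CFC.negPart_nonneg T)
  -- Conjugating by `T⁻` isolates the negative part, so every functional is both `≤ 0` and `≥ 0` on
  -- its cube.
  have h3 : star T⁻ * T * T⁻ = -(star T⁻ * T⁻ * T⁻) := by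
    conv_lhs => enter [1, 2]; rw [← CFC.posPart_sub_negPart T]
    rw [hn.star_eq, mul_sub, CFC.negPart_mul_posPart]
    simp
  have hcube : star T⁻ * T⁻ * T⁻ = 0 := by
    refine hsep _ fun ζ => le_antisymm ?_ (hf ζ _ ?_)
    · have := hT ζ T⁻
      rw [h3, map_neg] at this
      exact neg_nonneg.1 this
    · exact star_left_conjugate_nonneg (CFC.negPart_nonneg T) T⁻ |>.trans_eq (by rw [mul_assoc])
  have hzero : T⁻ = 0 := by
    rw [hn.star_eq] at hcube
    have h4 : star (T⁻ * T⁻) * (T⁻ * T⁻) = 0 := by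
      rw [star_mul, hn.star_eq, mul_assoc, ← mul_assoc T⁻ T⁻ T⁻, hcube, mul_zero]
    have h5 := (CStarRing.star_mul_self_eq_zero_iff _).1 h4
    rw [← CStarRing.star_mul_self_eq_zero_iff, hn.star_eq, h5]
  rw [← CFC.posPart_sub_negPart T, hzero, sub_zero]
  exact CFC.posPart_nonneg T

end PositiveFunctionals

/-! ### Vector functionals on matrices over a C⋆-algebra. -/

section MatrixForms

variable {H : Type*} [NormedAddCommGroup H] [InnerProductSpace ℂ H] 
variable {B : Type*} [CStarAlgebra B]

section

variable [PartialOrder B] [StarOrderedRing B]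

lemma nonneg_star_row_mul_row {n : Type*} [Fintype n] (r : n → B) :
    0 ≤ (CStarMatrix.ofMatrix fun i j => star (r i) * r j : CStarMatrix n n B) := by
  classical
  rcases isEmpty_or_nonempty n with h | ⟨⟨k⟩⟩
  · exact le_of_eq (by ext i; exact h.elim i)
  · let R : CStarMatrix n n B := CStarMatrix.ofMatrix fun i j => if i = k then r j else 0
    refine (star_mul_self_nonneg R).trans_eq ?_
    ext i j
    rw [CStarMatrix.mul_apply, Finset.sum_eq_single k]
    · change star (if k = k then r i else 0) * (if k = k then r j else 0) = star (r i) * r j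
      simp
    · intro l _ hl
      change star (if l = k then r i else 0) * (if l = k then r j else 0) = 0
      simp [hl]
    · simp

/-- A linear map `φ` on a subalgebra of `B` all of whose matrix forms are bounded by the norm of
`B`: each form extends to a positive functional on matrices over `B`. -/
lemma exists_positive_extension {A : Subalgebra ℂ B} (φ : A →ₗ[ℂ] (H →L[ℂ] H)) (h1 : φ 1 = 1)
    {n : ℕ} (h : Fin n → H)
    (hφ : ∀ a : CStarMatrix (Fin n) (Fin n) A, ‖∑ i, ∑ j, ⟪h i, φ (a i j) (h j)⟫_ℂ‖ ≤
      ‖a.map (Subtype.val : A → B)‖ * ∑ i, ‖h i‖ ^ 2) :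
    ∃ F : CStarMatrix (Fin n) (Fin n) B →ₗ[ℂ] ℂ, (∀ x, 0 ≤ x → 0 ≤ F x) ∧
      ∀ a : CStarMatrix (Fin n) (Fin n) A,
        F (a.map (Subtype.val : A → B)) = ∑ i, ∑ j, ⟪h i, φ (a i j) (h j)⟫_ℂ := by
  let V : Submodule ℂ (CStarMatrix (Fin n) (Fin n) B) :=
    { carrier := {x | ∀ i j, x i j ∈ A}
      add_mem' := fun hx hy i j => A.add_mem (hx i j) (hy i j)
      zero_mem' := fun i j => A.zero_mem
      smul_mem' := fun c x hx i j => A.smul_mem (hx i j) c }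
  let l : V →ₗ[ℂ] ℂ :=
    { toFun := fun x => ∑ i, ∑ j, ⟪h i, φ ⟨x.1 i j, x.2 i j⟩ (h j)⟫_ℂ
      map_add' := fun x y => by
        have e (i j) : (⟨(x + y).1 i j, (x + y).2 i j⟩ : A) =
          ⟨x.1 i j, x.2 i j⟩ + ⟨y.1 i j, y.2 i j⟩ := rfl
        simp only [e, map_add, add_apply, inner_add_right,
          Finset.sum_add_distrib]
      map_smul' := fun c x => by
        have e (i j) : (⟨(c • x).1 i j, (c • x).2 i j⟩ : A) = c • ⟨x.1 i j, x.2 i j⟩ := rfl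
        simp only [e, map_smul, smul_apply, inner_smul_right,
          Finset.mul_sum, RingHom.id_apply, smul_eq_mul] }
  have hl (x : V) : ‖l x‖ ≤ (∑ i, ‖h i‖ ^ 2) * ‖x‖ :=
    (hφ (CStarMatrix.ofMatrix fun i j => ⟨x.1 i j, x.2 i j⟩)).trans_eq (mul_comm _ _)
  have hc : 0 ≤ ∑ i, ‖h i‖ ^ 2 := Finset.sum_nonneg fun i _ => sq_nonneg _
  -- The extension has norm at most `∑ ‖h i‖ ^ 2`, which is its value at `1` because `φ 1 = 1`; this
  -- forces positivity.
  obtain ⟨g, hg, hgn⟩ := exists_extension_norm_eq V (l.mkContinuous _ hl)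
  have hgl (a : CStarMatrix (Fin n) (Fin n) A) :
      g (a.map (Subtype.val : A → B)) = ∑ i, ∑ j, ⟪h i, φ (a i j) (h j)⟫_ℂ :=
    hg ⟨a.map (Subtype.val : A → B), fun i j => (a i j).2⟩
  refine ⟨g.toLinearMap, fun x hx => nonneg_of_norm_le_of_map_one hc (fun x => ?_) ?_ hx, hgl⟩
  · refine (g.le_opNorm x).trans ?_
    rw [mul_comm, hgn]
    gcongr
    exact l.mkContinuous_norm_le hc hl
  · have e : (1 : CStarMatrix (Fin n) (Fin n) B) =
        (1 : CStarMatrix (Fin n) (Fin n) A).map Subtype.val := by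
      ext i j
      by_cases hij : i = j <;> simp [CStarMatrix.one_apply, hij]
    rw [ContinuousLinearMap.coe_coe, e, hgl]
    push_cast
    refine Finset.sum_congr rfl fun i _ => ?_
    rw [Finset.sum_eq_single i]
    · simp [h1]
    · intro j _ hj
      simp [CStarMatrix.one_apply_ne hj.symm]
    · simp

end

variable [CompleteSpace H]

/-- The functional `T ↦ ∑ ⟪hᵢ, ρ Tᵢⱼ hⱼ⟫` on matrices over `B`. -/
noncomputable def matrixForm {n : Type*} [Fintype n] (ρ : B →⋆ₐ[ℂ] (H →L[ℂ] H)) (h : n → H) :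
    CStarMatrix n n B →ₗ[ℂ] ℂ where
  toFun T := ∑ i, ∑ j, ⟪h i, ρ (T i j) (h j)⟫_ℂ
  map_add' S T := by simp [Finset.sum_add_distrib]
  map_smul' c T := by simp [Finset.mul_sum]

lemma matrixForm_apply {n : Type*} [Fintype n] (ρ : B →⋆ₐ[ℂ] (H →L[ℂ] H)) (h : n → H)
    (T : CStarMatrix n n B) : matrixForm ρ h T = ∑ i, ∑ j, ⟪h i, ρ (T i j) (h j)⟫_ℂ := rfl

lemma matrixForm_one {n : Type*} [Fintype n] [DecidableEq n] (ρ : B →⋆ₐ[ℂ] (H →L[ℂ] H))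
    (h : n → H) : matrixForm ρ h 1 = ((∑ i, ‖h i‖ ^ 2 : ℝ) : ℂ) := by
  rw [matrixForm_apply]
  push_cast
  refine Finset.sum_congr rfl fun i _ => ?_
  rw [Finset.sum_eq_single i]
  · simp
  · intro j _ hj
    simp [CStarMatrix.one_apply_ne hj.symm]
  · simp

/-- Conjugation by `S` moves onto the vectors, so the class of vector functionals is stable under
it. -/
lemma matrixForm_star_mul_mul {n : Type*} [Fintype n] (ρ : B →⋆ₐ[ℂ] (H →L[ℂ] H))
    (h : n → H) (S T : CStarMatrix n n B) :
    matrixForm ρ h (star S * T * S) = matrixForm ρ (fun i => ∑ j, ρ (S i j) (h j)) T := by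
  simp only [matrixForm_apply, CStarMatrix.mul_apply, CStarMatrix.star_apply, map_sum, map_mul,
    map_star, sum_inner, inner_sum, sum_apply, mul_apply_eq_comp,
    Finset.sum_mul, ContinuousLinearMap.star_eq_adjoint, ContinuousLinearMap.adjoint_inner_right]
  calc _ = ∑ a, ∑ p, ∑ q, ∑ b, ⟪ρ (S p a) (h a), ρ (T p q) (ρ (S q b) (h b))⟫_ℂ :=
        Finset.sum_congr rfl fun a _ =>
          (Finset.sum_congr rfl fun b _ => Finset.sum_comm).trans
            (Finset.sum_comm.trans (Finset.sum_congr rfl fun p _ => Finset.sum_comm))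
    _ = ∑ p, ∑ q, ∑ a, ∑ b, ⟪ρ (S p a) (h a), ρ (T p q) (ρ (S q b) (h b))⟫_ℂ := by
        rw [Finset.sum_comm]
        exact Finset.sum_congr rfl fun p _ => Finset.sum_comm
    _ = _ := Finset.sum_congr rfl fun p _ => Finset.sum_congr rfl fun q _ => Finset.sum_comm

variable [PartialOrder B] [StarOrderedRing B]

lemma matrixForm_nonneg {n : Type*} [Fintype n] (ρ : B →⋆ₐ[ℂ] (H →L[ℂ] H)) (h : n → H)
    {T : CStarMatrix n n B} (hT : 0 ≤ T) : 0 ≤ matrixForm ρ h T := by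
  classical
  obtain ⟨S, rfl⟩ := exists_eq_star_mul_self hT
  rw [← mul_one (star S), matrixForm_star_mul_mul, matrixForm_one]
  exact Complex.zero_le_real.2 (Finset.sum_nonneg fun i _ => sq_nonneg _)

lemma norm_matrixForm_le {n : Type*} [Fintype n] (ρ : B →⋆ₐ[ℂ] (H →L[ℂ] H)) (h : n → H)
    (T : CStarMatrix n n B) : ‖matrixForm ρ h T‖ ≤ ‖T‖ * ∑ i, ‖h i‖ ^ 2 := by
  classical
  have := positiveFunctional_norm_le (f := matrixForm ρ h)
    (fun _ hx => matrixForm_nonneg ρ h hx) T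
  rwa [matrixForm_one, Complex.ofReal_re] at this

lemma eq_zero_of_matrixForm_eq_zero {n : Type*} [Fintype n] (T : CStarMatrix n n (H →L[ℂ] H))
    (hT : ∀ h : n → H, matrixForm (StarAlgHom.id ℂ _) h T = 0) : T = 0 := by
  classical
  -- `T` acting on the Hilbert sum of copies of `H`: over `ℂ`, a vanishing quadratic form forces a
  -- vanishing operator.
  let L : PiLp 2 (fun _ : n => H) →ₗ[ℂ] PiLp 2 (fun _ : n => H) :=
    { toFun := fun v => WithLp.toLp 2 fun i => ∑ j, T i j (v j)
      map_add' := fun v w => by ext i; simp [Finset.sum_add_distrib]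
      map_smul' := fun c v => by ext i; simp [Finset.smul_sum] }
  have hL : L = 0 := by
    rw [← inner_map_self_eq_zero]
    intro v
    rw [← inner_conj_symm]
    have := hT v
    simp only [matrixForm_apply, StarAlgHom.coe_id, id_eq] at this
    simp only [PiLp.inner_apply, L, LinearMap.coe_mk, AddHom.coe_mk, inner_sum]
    rw [this, map_zero]
  ext i j x
  have h1 : L (WithLp.toLp 2 (Pi.single j x)) i = 0 := by rw [hL]; rfl
  simp only [L, LinearMap.coe_mk, AddHom.coe_mk] at h1
  rw [Finset.sum_eq_single j] at h1
  · simpa using h1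
  · intro k _ hk
    simp [Pi.single_eq_of_ne hk]
  · simp

/-- A matrix of operators is nonnegative when all its quadratic forms are. -/
lemma nonneg_of_matrixForm_nonneg {n : Type*} [Fintype n] {T : CStarMatrix n n (H →L[ℂ] H)}
    (hT : ∀ h : n → H, 0 ≤ matrixForm (StarAlgHom.id ℂ _) h T) : 0 ≤ T := by
  classical
  refine nonneg_of_separating_functionals (fun h : n → H => matrixForm (StarAlgHom.id ℂ _) h)
    (fun h x hx => matrixForm_nonneg _ h hx) eq_zero_of_matrixForm_eq_zero fun h y => ?_
  rw [matrixForm_star_mul_mul]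
  exact hT _

end MatrixForms

/-! ### Positive kernels and completely positive maps. -/

section Kernels

lemma sesquilinear_polarization {V : Type*} [AddCommGroup V] [Module ℂ V] (s : V → V → ℂ)
    (add_left : ∀ ξ ξ' η, s (ξ + ξ') η = s ξ η + s ξ' η)
    (smul_left : ∀ (c : ℂ) ξ η, s (c • ξ) η = star c * s ξ η)
    (add_right : ∀ ξ η η', s ξ (η + η') = s ξ η + s ξ η')
    (smul_right : ∀ (c : ℂ) ξ η, s ξ (c • η) = c * s ξ η) (ξ η : V) :
    s ξ η = (1 / 4) * (s (ξ + (1 : ℂ) • η) (ξ + (1 : ℂ) • η)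
      - s (ξ + (-1 : ℂ) • η) (ξ + (-1 : ℂ) • η)
      - Complex.I * s (ξ + Complex.I • η) (ξ + Complex.I • η)
      + Complex.I * s (ξ + (-Complex.I) • η) (ξ + (-Complex.I) • η)) := by
  simp only [add_left, smul_left, add_right, smul_right, star_neg, star_one, Complex.star_def,
    Complex.conj_I]
  linear_combination (1 / 2 * (s ξ η - s η ξ)) * Complex.I_sq

variable {H : Type*} [NormedAddCommGroup H] [InnerProductSpace ℂ H]
variable {B : Type*} [CStarAlgebra B]

lemma sum_norm_sq_polarization (ξ η : H) :
    ‖ξ + (1 : ℂ) • η‖ ^ 2 + ‖ξ + (-1 : ℂ) • η‖ ^ 2 + ‖ξ + Complex.I • η‖ ^ 2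
      + ‖ξ + (-Complex.I) • η‖ ^ 2 = 4 * (‖ξ‖ ^ 2 + ‖η‖ ^ 2) := by
  have h1 := parallelogram_law_with_norm ℂ ξ η
  have h2 := parallelogram_law_with_norm ℂ ξ (Complex.I • η)
  rw [norm_smul, Complex.norm_I, one_mul] at h2
  simp only [one_smul, neg_smul, ← sub_eq_add_neg]
  linarith

/-- A family of sesquilinear forms on `H` indexed linearly by `B`, satisfying the positivity of
`(x, ξ, η) ↦ ⟪ξ, Ψ x η⟫` for a completely positive contraction `Ψ`. -/
structure IsPositiveKernel (K : B → H → H → ℂ) : Prop where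
  map_add : ∀ x y ξ η, K (x + y) ξ η = K x ξ η + K y ξ η
  map_smul : ∀ (c : ℂ) x ξ η, K (c • x) ξ η = c * K x ξ η
  add_left : ∀ x ξ ξ' η, K x (ξ + ξ') η = K x ξ η + K x ξ' η
  smul_left : ∀ (c : ℂ) x ξ η, K x (c • ξ) η = star c * K x ξ η
  add_right : ∀ x ξ η η', K x ξ (η + η') = K x ξ η + K x ξ η'
  smul_right : ∀ (c : ℂ) x ξ η, K x ξ (c • η) = c * K x ξ η
  nonneg : ∀ (k : ℕ) (y : Fin k → B) (ζ : Fin k → H),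
    0 ≤ ∑ p, ∑ q, K (star (y p) * y q) (ζ p) (ζ q)
  one_le : ∀ ξ, (K 1 ξ ξ).re ≤ ‖ξ‖ ^ 2

namespace IsPositiveKernel

/-- Positive kernels are closed under pointwise limits. -/
lemma of_tendsto {α : Type*} {l : Filter α} [l.NeBot] {Ks : α → B → H → H → ℂ}
    {K : B → H → H → ℂ} (hKs : ∀ s, IsPositiveKernel (Ks s))
    (hK : ∀ x ξ η, Filter.Tendsto (fun s => Ks s x ξ η) l (𝓝 (K x ξ η))) :
    IsPositiveKernel K where
  map_add x y ξ η := tendsto_nhds_unique (hK _ _ _) <|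
    ((hK x ξ η).add (hK y ξ η)).congr fun s => ((hKs s).map_add ..).symm
  map_smul c x ξ η := tendsto_nhds_unique (hK _ _ _) <|
    ((hK x ξ η).const_mul c).congr fun s => ((hKs s).map_smul ..).symm
  add_left x ξ ξ' η := tendsto_nhds_unique (hK _ _ _) <|
    ((hK x ξ η).add (hK x ξ' η)).congr fun s => ((hKs s).add_left ..).symm
  smul_left c x ξ η := tendsto_nhds_unique (hK _ _ _) <|
    ((hK x ξ η).const_mul (star c)).congr fun s => ((hKs s).smul_left ..).symm
  add_right x ξ η η' := tendsto_nhds_unique (hK _ _ _) <|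
    ((hK x ξ η).add (hK x ξ η')).congr fun s => ((hKs s).add_right ..).symm
  smul_right c x ξ η := tendsto_nhds_unique (hK _ _ _) <|
    ((hK x ξ η).const_mul c).congr fun s => ((hKs s).smul_right ..).symm
  nonneg k y ζ := ge_of_tendsto
    (tendsto_finsetSum _ fun p _ => tendsto_finsetSum _ fun q _ => hK _ (ζ p) (ζ q))
    (Filter.Eventually.of_forall fun s => (hKs s).nonneg k y ζ)
  one_le ξ := le_of_tendsto ((Complex.continuous_re.tendsto _).comp (hK 1 ξ ξ))
    (Filter.Eventually.of_forall fun s => (hKs s).one_le ξ)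

variable [PartialOrder B] [StarOrderedRing B] {K : B → H → H → ℂ}

lemma norm_diag_le (hK : IsPositiveKernel K) (x : B) (ξ : H) : ‖K x ξ ξ‖ ≤ ‖x‖ * ‖ξ‖ ^ 2 := by
  let f : B →ₗ[ℂ] ℂ :=
    { toFun := fun x => K x ξ ξ
      map_add' := fun x y => hK.map_add x y ξ ξ
      map_smul' := fun c x => hK.map_smul c x ξ ξ }
  have hf (x : B) (hx : 0 ≤ x) : 0 ≤ f x := by
    obtain ⟨y, rfl⟩ := exists_eq_star_mul_self hx
    simpa using! hK.nonneg 1 (fun _ => y) (fun _ => ξ)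
  refine (positiveFunctional_norm_le hf x).trans ?_
  gcongr
  exact hK.one_le ξ

lemma norm_le_add (hK : IsPositiveKernel K) (x : B) (ξ η : H) :
    ‖K x ξ η‖ ≤ ‖x‖ * (‖ξ‖ ^ 2 + ‖η‖ ^ 2) := by
  rw [sesquilinear_polarization (K x) (hK.add_left x) (fun c => hK.smul_left c x)
    (hK.add_right x) (fun c => hK.smul_right c x) ξ η, norm_mul]
  have h1 := hK.norm_diag_le x (ξ + (1 : ℂ) • η)
  have h2 := hK.norm_diag_le x (ξ + (-1 : ℂ) • η)
  have h3 := hK.norm_diag_le x (ξ + Complex.I • η)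
  have h4 := hK.norm_diag_le x (ξ + (-Complex.I) • η)
  have h5 := congrArg (‖x‖ * ·) (sum_norm_sq_polarization ξ η)
  beta_reduce at h5
  have h6 : ‖(1 / 4 : ℂ)‖ = 1 / 4 := by norm_num
  rw [h6]
  have n1 (a b c d : ℂ) : ‖a - b - Complex.I * c + Complex.I * d‖ ≤ ‖a‖ + ‖b‖ + ‖c‖ + ‖d‖ := by
    refine (norm_add_le _ _).trans (add_le_add ((norm_sub_le _ _).trans
      (add_le_add (norm_sub_le _ _) ?_)) ?_) <;> simp
  have h7 := n1 (K x (ξ + (1 : ℂ) • η) (ξ + (1 : ℂ) • η))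
    (K x (ξ + (-1 : ℂ) • η) (ξ + (-1 : ℂ) • η))
    (K x (ξ + Complex.I • η) (ξ + Complex.I • η))
    (K x (ξ + (-Complex.I) • η) (ξ + (-Complex.I) • η))
  linarith

/-- Normalizing both vectors makes the additive bound homogeneous. The factor 2 is harmless: only a
bound independent of `K` is needed. -/
lemma norm_le_mul (hK : IsPositiveKernel K) (x : B) (ξ η : H) :
    ‖K x ξ η‖ ≤ 2 * ‖x‖ * ‖ξ‖ * ‖η‖ := by
  have hl : ‖ξ‖ = 0 → K x ξ η = 0 := fun h => by
    have := hK.smul_left 0 x ξ η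
    rwa [zero_smul, star_zero, zero_mul, ← norm_eq_zero.1 h] at this
  have hr : ‖η‖ = 0 → K x ξ η = 0 := fun h => by
    have := hK.smul_right 0 x ξ η
    rwa [zero_smul, zero_mul, ← norm_eq_zero.1 h] at this
  by_cases hξ : ‖ξ‖ = 0
  · rw [hl hξ, norm_zero]; positivity
  by_cases hη : ‖η‖ = 0
  · rw [hr hη, norm_zero]; positivity
  have h := hK.norm_le_add x (((‖ξ‖⁻¹ : ℝ) : ℂ) • ξ) (((‖η‖⁻¹ : ℝ) : ℂ) • η)
  rw [hK.smul_left, hK.smul_right, norm_mul, norm_mul, norm_smul, norm_smul, norm_star,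
    Complex.norm_real, Complex.norm_real, norm_inv, norm_inv, norm_norm, norm_norm,
    inv_mul_cancel₀ hξ, inv_mul_cancel₀ hη] at h
  have h' : ‖ξ‖⁻¹ * (‖η‖⁻¹ * ‖K x ξ η‖) * (‖ξ‖ * ‖η‖) ≤
      ‖x‖ * (1 ^ 2 + 1 ^ 2) * (‖ξ‖ * ‖η‖) := by gcongr
  calc ‖K x ξ η‖ = ‖ξ‖⁻¹ * (‖η‖⁻¹ * ‖K x ξ η‖) * (‖ξ‖ * ‖η‖) := by field_simp
    _ ≤ _ := h'
    _ = _ := by ring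

/-- A positive kernel comes from a completely positive map. -/
lemma exists_completelyPositiveMap [CompleteSpace H] (hK : IsPositiveKernel K) :
    ∃ Ψ : B →CP (H →L[ℂ] H), ∀ x ξ η, ⟪ξ, Ψ x η⟫_ℂ = K x ξ η := by
  let form (x : B) : H →L⋆[ℂ] H →L[ℂ] ℂ :=
    LinearMap.mkContinuous₂
      (LinearMap.mk₂'ₛₗ (starRingEnd ℂ) (RingHom.id ℂ) (K x) (hK.add_left x)
        (fun c ξ η => hK.smul_left c x ξ η) (hK.add_right x) (fun c ξ η => hK.smul_right c x ξ η))
      (2 * ‖x‖) (hK.norm_le_mul x)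
  have hop (x : B) : ∃ T : H →L[ℂ] H, ∀ ξ η, ⟪ξ, T η⟫_ℂ = K x ξ η := by
    -- The Riesz operator sits in the left slot of the inner product; the adjoint moves it to the
    -- right.
    refine ⟨(InnerProductSpace.continuousLinearMapOfBilin (form x)).adjoint, fun ξ η => ?_⟩
    rw [ContinuousLinearMap.adjoint_inner_right,
      InnerProductSpace.continuousLinearMapOfBilin_apply]
    rfl
  choose T hT using hop
  refine ⟨{ toFun := T, map_add' := fun x y => ?_, map_smul' := fun c x => ?_,
            map_cstarMatrix_nonneg' := fun k X hX => ?_ }, hT⟩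
  · ext η
    refine ext_inner_left ℂ fun ξ => ?_
    rw [add_apply, inner_add_right, hT, hT, hT, hK.map_add]
  · ext η
    refine ext_inner_left ℂ fun ξ => ?_
    rw [RingHom.id_apply, smul_apply, inner_smul_right, hT, hT, hK.map_smul]
  · refine nonneg_of_matrixForm_nonneg fun h => ?_
    obtain ⟨Y, rfl⟩ := exists_eq_star_mul_self hX
    -- `star Y * Y` is a sum over the rows of `Y`, and each row is one instance of `nonneg`.
    have key (i j : Fin k) : ⟪h i, T ((star Y * Y) i j) (h j)⟫_ℂ =
        ∑ t, K (star (Y t i) * Y t j) (h i) (h j) := by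
      let f : B →ₗ[ℂ] ℂ :=
        { toFun := fun x => K x (h i) (h j)
          map_add' := fun x y => hK.map_add x y _ _
          map_smul' := fun c x => hK.map_smul c x _ _ }
      rw [hT]
      change f ((star Y * Y) i j) = ∑ t, f (star (Y t i) * Y t j)
      rw [CStarMatrix.mul_apply, map_sum f]
      simp only [CStarMatrix.star_apply]
    have : matrixForm (StarAlgHom.id ℂ _) h ((star Y * Y).map T) =
        ∑ t, ∑ i, ∑ j, K (star (Y t i) * Y t j) (h i) (h j) := by
      rw [Finset.sum_comm, matrixForm_apply]
      refine Finset.sum_congr rfl fun i _ => ?_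
      rw [Finset.sum_comm]
      exact Finset.sum_congr rfl fun j _ => key i j
    refine (Finset.sum_nonneg fun t _ => hK.nonneg k (Y t) h).trans_eq this.symm

end IsPositiveKernel

end Kernels

/-! ### Arveson extension by finite compressions. -/

section Extension

variable {H : Type*} [NormedAddCommGroup H] [InnerProductSpace ℂ H]
variable {B : Type*} [CStarAlgebra B] [PartialOrder B] [StarOrderedRing B]
variable {A : Subalgebra ℂ B}

/-- For a finite orthonormal family `v`, the compression of `φ` to the span of `v` extends to a
positive kernel. -/
lemma exists_positiveKernel_of_orthonormal (φ : A →ₗ[ℂ] (H →L[ℂ] H)) (h1 : φ 1 = 1) {n : ℕ}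
    {v : Fin n → H} (hv : Orthonormal ℂ v)
    (hφ : ∀ a : CStarMatrix (Fin n) (Fin n) A, ‖∑ i, ∑ j, ⟪v i, φ (a i j) (v j)⟫_ℂ‖ ≤
      ‖a.map (Subtype.val : A → B)‖ * ∑ i, ‖v i‖ ^ 2) :
    ∃ K : B → H → H → ℂ, IsPositiveKernel K ∧
      ∀ (a : A) ξ η, K a ξ η = ⟪∑ i, ⟪v i, ξ⟫_ℂ • v i, φ a (∑ i, ⟪v i, η⟫_ℂ • v i)⟫_ℂ := by
  obtain ⟨F, hFpos, hF⟩ := exists_positive_extension φ h1 v hφ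
  -- The coordinates of `ξ` and `η` along `v`, tensored with `x`; `F` of it plays the role of the
  -- compressed form.
  let X (x : B) (ξ η : H) : CStarMatrix (Fin n) (Fin n) B :=
    CStarMatrix.ofMatrix fun i j => (star ⟪v i, ξ⟫_ℂ * ⟪v j, η⟫_ℂ) • x
  have hX (x : B) (ξ η : H) (i j) : X x ξ η i j = (star ⟪v i, ξ⟫_ℂ * ⟪v j, η⟫_ℂ) • x := rfl
  have hA (a : A) (ξ η : H) : F (X a ξ η) =
      ⟪∑ i, ⟪v i, ξ⟫_ℂ • v i, φ a (∑ i, ⟪v i, η⟫_ℂ • v i)⟫_ℂ := by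
    have e : X a ξ η = CStarMatrix.map (CStarMatrix.ofMatrix fun i j =>
        (star ⟪v i, ξ⟫_ℂ * ⟪v j, η⟫_ℂ) • a) (Subtype.val : A → B) := rfl
    rw [e, hF]
    change ∑ i, ∑ j, ⟪v i, φ ((star ⟪v i, ξ⟫_ℂ * ⟪v j, η⟫_ℂ) • a) (v j)⟫_ℂ = _
    simp only [sum_inner, map_sum, inner_sum, map_smul, inner_smul_left, inner_smul_right,
      smul_apply, Complex.star_def, Finset.mul_sum]
    rw [Finset.sum_comm]
    exact Finset.sum_congr rfl fun i _ => Finset.sum_congr rfl fun j _ => by ring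
  refine ⟨fun x ξ η => F (X x ξ η), ⟨?_, ?_, ?_, ?_, ?_, ?_, ?_, ?_⟩, hA⟩
  · intro x y ξ η
    rw [← map_add]; congr 1; ext i j; simp [hX]
  · intro c x ξ η
    rw [← smul_eq_mul, ← map_smul]; congr 1; ext i j; simp only [hX, CStarMatrix.smul_apply]
    exact smul_comm _ _ _
  · intro x ξ ξ' η
    rw [← map_add]; congr 1; ext i j; simp [hX, add_mul, add_smul]
  · intro c x ξ η
    rw [← smul_eq_mul, ← map_smul]; congr 1; ext i j
    simp [hX, smul_smul, mul_assoc]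
  · intro x ξ η η'
    rw [← map_add]; congr 1; ext i j; simp [hX, mul_add, add_smul]
  · intro c x ξ η
    rw [← smul_eq_mul, ← map_smul]; congr 1; ext i j
    simp [hX, smul_smul, mul_left_comm]
  · intro k y ζ
    refine (hFpos _ (nonneg_star_row_mul_row fun i => ∑ p, ⟪v i, ζ p⟫_ℂ • y p)).trans_eq ?_
    simp only [← map_sum]
    congr 1
    ext i j
    have happ (g : Fin k → CStarMatrix (Fin n) (Fin n) B) : (∑ p, g p) i j = ∑ p, g p i j := by
      let ev : CStarMatrix (Fin n) (Fin n) B →+ B :=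
        { toFun := fun x => x i j, map_zero' := rfl, map_add' := fun _ _ => rfl }
      exact map_sum ev g Finset.univ
    rw [happ]
    simp only [happ, hX]
    change star (∑ p, ⟪v i, ζ p⟫_ℂ • y p) * (∑ q, ⟪v j, ζ q⟫_ℂ • y q) = _
    simp only [star_sum, star_smul, Finset.sum_mul, Finset.mul_sum, smul_mul_smul_comm]
    exact Finset.sum_comm
  -- At `1` the kernel is the projection onto the span of `v`, so this is Bessel's inequality.
  · intro ξ
    have := hA 1 ξ ξ
    rw [OneMemClass.coe_one, h1, one_apply_eq_self, hv.inner_sum] at this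
    rw [this, Complex.re_sum]
    refine le_trans (le_of_eq ?_) (hv.sum_inner_products_le ξ (s := Finset.univ))
    refine Finset.sum_congr rfl fun i _ => ?_
    rw [mul_comm, Complex.mul_conj, Complex.ofReal_re, Complex.normSq_eq_norm_sq]

/-- **Arveson's extension theorem** for unital maps with contractive matrix forms. -/
theorem exists_completelyPositive_extension [CompleteSpace H] (φ : A →ₗ[ℂ] (H →L[ℂ] H))
    (h1 : φ 1 = 1)
    (hφ : ∀ (n : ℕ) (v : Fin n → H) (a : CStarMatrix (Fin n) (Fin n) A),
      ‖∑ i, ∑ j, ⟪v i, φ (a i j) (v j)⟫_ℂ‖ ≤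
        ‖a.map (Subtype.val : A → B)‖ * ∑ i, ‖v i‖ ^ 2) :
    ∃ Ψ : B →CP (H →L[ℂ] H), ∀ a : A, Ψ a = φ a := by
  obtain ⟨w, b, -⟩ := exists_hilbertBasis ℂ H
  have stage (S : Finset w) : ∃ K : B → H → H → ℂ, IsPositiveKernel K ∧ ∀ (a : A) ξ η,
      K a ξ η = ⟪∑ i ∈ S, ⟪b i, ξ⟫_ℂ • b i, φ a (∑ i ∈ S, ⟪b i, η⟫_ℂ • b i)⟫_ℂ := by
    let e : Fin S.card ≃ S := S.equivFin.symm
    have hv : Orthonormal ℂ fun i => b (e i) :=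
      b.orthonormal.comp _ (Subtype.val_injective.comp e.injective)
    obtain ⟨K, hK, hKA⟩ := exists_positiveKernel_of_orthonormal φ h1 hv (hφ _ _)
    have hsum (ξ : H) : ∑ i, ⟪b (e i), ξ⟫_ℂ • b (e i) = ∑ i ∈ S, ⟪b i, ξ⟫_ℂ • b i := by
      rw [e.sum_comp fun i : S => ⟪b i, ξ⟫_ℂ • b i, Finset.sum_coe_sort S fun i => ⟪b i, ξ⟫_ℂ • b i]
    exact ⟨K, hK, fun a ξ η => by rw [hKA, hsum, hsum]⟩
  choose Ks hKs hKsA using stage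
  let U : Ultrafilter (Finset w) := Ultrafilter.of Filter.atTop
  have hU : (U : Filter (Finset w)) ≤ Filter.atTop := Ultrafilter.of_le _
  -- The bound `norm_le_mul` does not depend on `S`, so the values stay in one compact disc.
  have hlim (x : B) (ξ η : H) :
      ∃ c : ℂ, Filter.Tendsto (fun S => Ks S x ξ η) (U : Filter (Finset w)) (𝓝 c) := by
    obtain ⟨c, -, hc⟩ := (isCompact_closedBall (0 : ℂ)
      (2 * ‖x‖ * ‖ξ‖ * ‖η‖)).ultrafilter_le_nhds (U.map fun S => Ks S x ξ η) (by
        rw [Filter.le_principal_iff, Ultrafilter.mem_coe, Ultrafilter.mem_map]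
        refine Filter.univ_mem' fun S => ?_
        simpa using (hKs S).norm_le_mul x ξ η)
    exact ⟨c, hc⟩
  choose K hK using hlim
  obtain ⟨Ψ, hΨ⟩ := (IsPositiveKernel.of_tendsto hKs hK).exists_completelyPositiveMap
  refine ⟨Ψ, fun a => ?_⟩
  ext η
  refine ext_inner_left ℂ fun ξ => ?_
  rw [hΨ]
  have hexp (ξ : H) : Filter.Tendsto (fun S : Finset w => ∑ i ∈ S, ⟪b i, ξ⟫_ℂ • b i)
      (U : Filter (Finset w)) (𝓝 ξ) := by
    have := b.hasSum_repr ξ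
    simp only [b.repr_apply_apply] at this
    exact Filter.Tendsto.mono_left this hU
  refine tendsto_nhds_unique (hK a ξ η) ?_
  simp only [hKsA]
  exact (hexp ξ).inner (((φ a).continuous.tendsto η).comp (hexp η))

end Extension

/-! ### Weak* continuity through diagonal functionals. -/

section Normality

variable {H : Type*} [NormedAddCommGroup H] [InnerProductSpace ℂ H]

lemma continuous_tsum_inner (ξ η : lp (fun _ : ℕ => H) 2) :
    Continuous[weakStarTopologyBH H, inferInstance]
      fun x : H →L[ℂ] H => ∑' n, ⟪ξ n, x (η n)⟫_ℂ := by
  rw [continuous_iff_le_induced]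
  exact (iInf_le _ ξ).trans (iInf_le _ η)

lemma summable_norm_sq {H : Type*} [NormedAddCommGroup H] (η : lp (fun _ : ℕ => H) 2) : Summable fun n => ‖η n‖ ^ 2 := by
  have := (lp.memℓp η).summable (by norm_num)
  simpa using this

lemma summable_inner_apply (T : H →L[ℂ] H) (ξ η : lp (fun _ : ℕ => H) 2) :
    Summable fun n => ⟪ξ n, T (η n)⟫_ℂ := by
  refine .of_norm_bounded (((summable_norm_sq ξ).add (summable_norm_sq η)).mul_left ‖T‖)
    fun n => ?_
  calc ‖⟪ξ n, T (η n)⟫_ℂ‖ ≤ ‖ξ n‖ * (‖T‖ * ‖η n‖) :=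
        (norm_inner_le_norm _ _).trans (by gcongr; exact T.le_opNorm _)
    _ = ‖T‖ * (‖ξ n‖ * ‖η n‖) := by ring
    _ ≤ ‖T‖ * (‖ξ n‖ ^ 2 + ‖η n‖ ^ 2) := by
        gcongr
        nlinarith [sq_nonneg (‖ξ n‖ - ‖η n‖), sq_nonneg ‖ξ n‖, sq_nonneg ‖η n‖]

/-- Reduces σ-weak functionals to diagonal ones, which become positive after composing with a
completely positive map; states are all the Gleason-Whitney property sees. -/
lemma tsum_inner_polarization (T : H →L[ℂ] H) (ξ η : lp (fun _ : ℕ => H) 2) :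
    let s := fun ζ : lp (fun _ : ℕ => H) 2 => ∑' n, ⟪ζ n, T (ζ n)⟫_ℂ
    ∑' n, ⟪ξ n, T (η n)⟫_ℂ = (1 / 4) * (s (ξ + (1 : ℂ) • η) - s (ξ + (-1 : ℂ) • η)
      - Complex.I * s (ξ + Complex.I • η) + Complex.I * s (ξ + (-Complex.I) • η)) := by
  refine sesquilinear_polarization (fun ξ η : lp (fun _ : ℕ => H) 2 => ∑' n, ⟪ξ n, T (η n)⟫_ℂ)
    (fun ξ ξ' η => ?_) (fun c ξ η => ?_) (fun ξ η η' => ?_) (fun c ξ η => ?_) ξ η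
  · rw [← (summable_inner_apply T ξ η).tsum_add (summable_inner_apply T ξ' η)]
    simp
  · rw [← tsum_mul_left]
    simp [mul_comm]
  · rw [← (summable_inner_apply T ξ η).tsum_add (summable_inner_apply T ξ η')]
    simp
  · rw [← tsum_mul_left]
    simp

/-- A map into `B(H)` is weak* continuous once its diagonal functionals are continuous. -/
lemma continuous_weakStarTopologyBH {X : Type*} [TopologicalSpace X] {f : X → H →L[ℂ] H}
    (hf : ∀ ζ : lp (fun _ : ℕ => H) 2, Continuous fun x => ∑' n, ⟪ζ n, f x (ζ n)⟫_ℂ) :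
    Continuous[inferInstance, weakStarTopologyBH H] f := by
  refine continuous_iInf_rng.2 fun ξ => continuous_iInf_rng.2 fun η => continuous_induced_rng.2 ?_
  have : (fun x : H →L[ℂ] H => ∑' n, ⟪ξ n, x (η n)⟫_ℂ) ∘ f = _ :=
    funext fun x => tsum_inner_polarization (f x) ξ η
  rw [this]
  exact continuous_const.mul <| (((hf _).sub (hf _)).sub (continuous_const.mul (hf _))).add
    (continuous_const.mul (hf _))

/-- The functional `x ↦ ∑ ⟪ζₙ, Ψ x ζₙ⟫`. -/
noncomputable def diagonalFunctional {E : Type*} [AddCommGroup E] [Module ℂ E]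
    (Ψ : E →ₗ[ℂ] (H →L[ℂ] H)) (ζ : lp (fun _ : ℕ => H) 2) : E →ₗ[ℂ] ℂ where
  toFun x := ∑' n, ⟪ζ n, Ψ x (ζ n)⟫_ℂ
  map_add' x y := by
    rw [← (summable_inner_apply _ ζ ζ).tsum_add (summable_inner_apply _ ζ ζ)]
    simp
  map_smul' c x := by
    rw [RingHom.id_apply, smul_eq_mul, ← tsum_mul_left]
    simp

lemma diagonalFunctional_nonneg [CompleteSpace H] {E : Type*} [CStarAlgebra E] [PartialOrder E]
    [StarOrderedRing E] (Ψ : E →CP (H →L[ℂ] H)) (ζ : lp (fun _ : ℕ => H) 2) {x : E}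
    (hx : 0 ≤ x) : 0 ≤ diagonalFunctional Ψ.toLinearMap ζ x := by
  have h0 : 0 ≤ Ψ x := by
    simpa using OrderHomClass.mono Ψ hx
  exact tsum_nonneg fun n =>
    ((ContinuousLinearMap.nonneg_iff_isPositive _).1 h0).inner_nonneg_right (ζ n)

end Normality

/-! ### Gleason-Whitney forces normality of the extension. -/

theorem mainTheorem11 {K H : Type*}
    [NormedAddCommGroup K] [InnerProductSpace ℂ K] [CompleteSpace K]
    [NormedAddCommGroup H] [InnerProductSpace ℂ H] [CompleteSpace H]
    (M : VonNeumannAlgebra K) (D : VonNeumannAlgebra H)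
    (A : Subalgebra ℂ M.toStarSubalgebra)
    (hA : IsClosed[M.weakStarTopology] (A : Set M.toStarSubalgebra))
    (hGW : ∀ φ : A →ₗ[ℂ] ℂ, IsUnitalContractiveState φ →
      Continuous[M.weakStarTopologyOn A, inferInstance] φ →
      ∀ ψ : M.toStarSubalgebra →ₗ[ℂ] ℂ, IsUnitalContractiveState ψ →
        (∀ a : A, ψ (a : M.toStarSubalgebra) = φ a) →
        Continuous[M.weakStarTopology, inferInstance] ψ)
    (Φ : A →ₗ[ℂ] D.toStarSubalgebra)
    (hΦ_one : Φ 1 = 1)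
    (hΦ_cont : Continuous[M.weakStarTopologyOn A, D.weakStarTopology] Φ)
    (hΦ_cc : IsCompletelyContractive A Φ) :
    ∃ Ψ : M.toStarSubalgebra →CP (H →L[ℂ] H),
      Continuous[M.weakStarTopology, weakStarTopologyBH H] Ψ ∧
      ∀ a : A, Ψ (a : M.toStarSubalgebra) = (Φ a : H →L[ℂ] H) := by
  let ρ : D.toStarSubalgebra →⋆ₐ[ℂ] (H →L[ℂ] H) := D.toStarSubalgebra.subtype
  let φ : A →ₗ[ℂ] (H →L[ℂ] H) := ρ.toAlgHom.toLinearMap ∘ₗ Φ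
  have hφ1 : φ 1 = 1 := by
    change ρ (Φ 1) = 1
    rw [hΦ_one, map_one]
  obtain ⟨Ψ, hΨ⟩ := exists_completelyPositive_extension φ hφ1 fun n v a =>
    (norm_matrixForm_le ρ v (a.map Φ)).trans
      (mul_le_mul_of_nonneg_right (hΦ_cc n a) (Finset.sum_nonneg fun i _ => sq_nonneg _))
  refine ⟨Ψ, ?_, hΨ⟩
  let _ : TopologicalSpace M.toStarSubalgebra := M.weakStarTopology
  refine @continuous_weakStarTopologyBH _ _ _ _ M.weakStarTopology _ fun ζ => ?_
  let c : ℝ := ∑' n, ‖ζ n‖ ^ 2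
  have hΨ1 : Ψ 1 = 1 := (hΨ 1).trans hφ1
  have hc1 : diagonalFunctional Ψ.toLinearMap ζ 1 = c := by
    change ∑' n, ⟪ζ n, Ψ 1 (ζ n)⟫_ℂ = _
    rw [hΨ1, Complex.ofReal_tsum]
    simp
  have hbound (x : M.toStarSubalgebra) : ‖diagonalFunctional Ψ.toLinearMap ζ x‖ ≤ ‖x‖ * c := by
    have := positiveFunctional_norm_le (fun _ hx => diagonalFunctional_nonneg Ψ ζ hx) x
    rwa [hc1, Complex.ofReal_re] at this
  have hc : 0 ≤ c := tsum_nonneg fun n => sq_nonneg _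
  -- `c` is the norming constant; if it vanishes, so does the functional.
  rcases hc.eq_or_lt with h0 | h0
  · have hz (x : M.toStarSubalgebra) : diagonalFunctional Ψ.toLinearMap ζ x = 0 := by
      have := hbound x
      rwa [← h0, mul_zero, norm_le_zero_iff] at this
    refine (continuous_const (y := (0 : ℂ))).congr fun x => (hz x).symm
  · let ψ : M.toStarSubalgebra →ₗ[ℂ] ℂ := (c : ℂ)⁻¹ • diagonalFunctional Ψ.toLinearMap ζ
    have hcC : (c : ℂ) ≠ 0 := Complex.ofReal_ne_zero.2 h0.ne'
    have hψ : IsUnitalContractiveState ψ := by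
      constructor
      · intro x
        rw [LinearMap.smul_apply, norm_smul, norm_inv, Complex.norm_real, Real.norm_of_nonneg hc,
          inv_mul_le_iff₀ h0, mul_comm]
        exact hbound x
      · rw [LinearMap.smul_apply, hc1, smul_eq_mul, inv_mul_cancel₀ hcC]
    have hψA : IsUnitalContractiveState (ψ ∘ₗ A.val.toLinearMap) :=
      ⟨fun a => hψ.1 a, hψ.2⟩
    -- On `A`, `Ψ` is `Φ`, so the restricted state is a σ-weak functional composed with the weak*
    -- continuous `Φ`.
    have hψAc : Continuous[M.weakStarTopologyOn A, inferInstance] (ψ ∘ₗ A.val.toLinearMap) := by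
      let _ : TopologicalSpace A := M.weakStarTopologyOn A
      have h1 := @Continuous.comp _ _ _ (M.weakStarTopologyOn A) D.weakStarTopology
        (weakStarTopologyBH H) _ _ (@continuous_induced_dom _ _ _ (weakStarTopologyBH H)) hΦ_cont
      have h2 := @Continuous.comp _ _ _ (M.weakStarTopologyOn A) (weakStarTopologyBH H) _ _ _
        (continuous_tsum_inner ζ ζ) h1
      refine (h2.const_mul (c : ℂ)⁻¹).congr fun a => ?_
      change _ = (c : ℂ)⁻¹ * ∑' n, ⟪ζ n, Ψ a (ζ n)⟫_ℂ
      rw [hΨ]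
      rfl
    have hψc := hGW _ hψA hψAc ψ hψ fun a => rfl
    refine (hψc.const_mul (c : ℂ)).congr fun x => ?_
    change (c : ℂ) * ((c : ℂ)⁻¹ * _) = _
    rw [mul_inv_cancel_left₀ hcC]
    rfl
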